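/- Let $z,q\in\mathbb{C}$ with $z\neq 0$, $z+1/z\neq 1$ and $|q|<1$. Write $(A;q)_n=\prod_{k=0}^{n-1}(1-Aq^k)$, $(A;q)_\infty=\prod_{k=0}^{\infty}(1-Aq^k)$ and $(A,B;q)_n=(A;q)_n(B;q)_n$ for $0\le n\le\infty$. Then the following series converges absolutely, and \[ \sum_{n=0}^{\infty}\frac{1-(z+1/z)q^n}{1-(z+1/z)}\,\frac{(-z^3,-1/z^3;q)_n\,q^{n^2}}{(q;q)_{2n}}=(zq,q/z;q)_\infty\,(qz^2,q/z^2;q^2)_\infty . \] -/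

import Mathlib

/-- The finite rising `q`-factorial `(a; q)_n = (1 - a) (1 - a q) ⋯ (1 - a q ^ (n - 1))`. -/
noncomputable def qPoch (a q : ℂ) (n : ℕ) : ℂ :=
  ∏ k ∈ Finset.range n, (1 - a * q ^ k)

/-- The infinite rising `q`-factorial `(a; q)_∞ = (1 - a) (1 - a q) (1 - a q ^ 2) ⋯`. -/
noncomputable def qPochInf (a q : ℂ) : ℂ :=
  ∏' k : ℕ, (1 - a * q ^ k)

/-- The infinite product defining `(a; q)_∞` converges for `|q| < 1`, so that the value of
`qPochInf` is never a default value there. -/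
theorem qPochInf_hasProd (a q : ℂ) (hq : ‖q‖ < 1) :
    HasProd (fun k : ℕ => 1 - a * q ^ k) (qPochInf a q) := by
  have h : Summable fun k : ℕ => ‖-(a * q ^ k)‖ := by
    simpa [norm_mul, norm_pow] using
      (summable_geometric_of_lt_one (norm_nonneg q) hq).mul_left ‖a‖
  have h2 := (multipliable_one_add_of_summable h).hasProd
  simpa [qPochInf, sub_eq_add_neg] using h2

/-! Put w = z³ and s = z + 1/z. The finite triple product `hasSum_finite_triple_symm` expands (-w,
-1/w; q)_n / (q; q)_{2n} in powers of w. Exchanging sums (`hasSum_lhs`) leaves, in the coefficient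
of w^j, the series A_j = ∑ `rowTerm q j n` and B_j = ∑ `rowTerm q j n` q^n. Neither is evaluated
alone, because of the denominators 1 + q^n, but two combinations lose these denominators and are
summed by the Durfee rectangle identity `tsum_durfeeTerm`: A_j + B_j, and one linking B_{j+1} to
B_j.

Let U = ∑ `qPent q j` w^j, V = ∑ `qPent q j` q^j w^j, R = ∑ `rowSum q j` w^j and P = (q; q)_∞. Then
(1 - s) times the left side is (U + V)/P - (1 + s) R, and the recurrence for B_j gives (1 - w) R =
(U - wV)/P (`tsum_rowSum_rec`). With w = z³ one has (1 - z)(1 + s) = (1 - z³)/z, so eliminating R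
leaves (1 - s)(U - zV)/((1 - z)P). The quintuple product identity `hasSum_quintuple` evaluates U -
zV as (1 - z)P times the required product. The excluded point z = 1 follows by continuity. -/

open Filter Topology

/-! ### Reciprocal q-factorials and triangular powers on ℤ -/

/-- The reciprocal `1 / (q; q)_m`, extended by `0` to negative `m`. -/
noncomputable def qPochRecip (q : ℂ) (m : ℤ) : ℂ :=
  if 0 ≤ m then (qPoch q q m.toNat)⁻¹ else 0

/-- The power `q ^ (j (j - 1) / 2)` for an integer `j`. -/
noncomputable def qTri (q : ℂ) (j : ℤ) : ℂ := q ^ (j * (j - 1) / 2)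

theorem qPoch_zero (a q : ℂ) : qPoch a q 0 = 1 := by simp [qPoch]

theorem qPoch_succ (a q : ℂ) (n : ℕ) : qPoch a q (n + 1) = qPoch a q n * (1 - a * q ^ n) := by
  simp [qPoch, Finset.prod_range_succ]

theorem tendsto_qPoch (a : ℂ) {q : ℂ} (hq : ‖q‖ < 1) :
    Tendsto (qPoch a q) atTop (𝓝 (qPochInf a q)) :=
  (qPochInf_hasProd a q hq).tendsto_prod_nat

theorem one_sub_pow_succ_ne_zero {q : ℂ} (hq : ‖q‖ < 1) (n : ℕ) : 1 - q ^ (n + 1) ≠ 0 := by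
  intro h
  have h1 : ‖q ^ (n + 1)‖ = 1 := by rw [← sub_eq_zero.mp h, norm_one]
  rw [norm_pow] at h1
  exact (pow_lt_one₀ (norm_nonneg q) hq n.succ_ne_zero).ne h1

theorem qPoch_self_ne_zero {q : ℂ} (hq : ‖q‖ < 1) (n : ℕ) : qPoch q q n ≠ 0 := by
  refine Finset.prod_ne_zero_iff.mpr fun k _ => ?_
  simpa [pow_succ'] using one_sub_pow_succ_ne_zero hq k

theorem qPochInf_self_ne_zero {q : ℂ} (hq : ‖q‖ < 1) : qPochInf q q ≠ 0 := by
  have h : Summable fun k : ℕ => ‖-(q * q ^ k)‖ := by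
    simpa [norm_mul, norm_pow] using
      (summable_geometric_of_lt_one (norm_nonneg q) hq).mul_left ‖q‖
  have h2 := tprod_one_add_ne_zero_of_summable (f := fun k : ℕ => -(q * q ^ k)) (fun k => by
    simpa [pow_succ', sub_eq_add_neg] using one_sub_pow_succ_ne_zero hq k) h
  simpa [qPochInf, sub_eq_add_neg] using h2

theorem qPochRecip_of_neg (q : ℂ) {m : ℤ} (hm : m < 0) : qPochRecip q m = 0 := by
  simp [qPochRecip, hm]

theorem qPochRecip_natCast (q : ℂ) (n : ℕ) : qPochRecip q n = (qPoch q q n)⁻¹ := by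
  simp [qPochRecip]

theorem qPochRecip_zero (q : ℂ) : qPochRecip q 0 = 1 := by
  simp [qPochRecip, qPoch_zero]

/-- Extension by zero is consistent with the recurrence because the factor 1 - q^m vanishes at m =
0. All later sums can therefore run over ℤ without boundary terms. -/
theorem qPochRecip_sub_one {q : ℂ} (hq : ‖q‖ < 1) (m : ℤ) :
    qPochRecip q (m - 1) = (1 - q ^ m) * qPochRecip q m := by
  rcases lt_trichotomy m 0 with h | rfl | h
  · rw [qPochRecip_of_neg q h, qPochRecip_of_neg q (by omega), mul_zero]
  · rw [qPochRecip_of_neg q (by omega)]; simp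
  · obtain ⟨n, rfl⟩ : ∃ n : ℕ, m = n + 1 := ⟨(m - 1).toNat, by omega⟩
    rw [add_sub_cancel_right, ← Nat.cast_succ, qPochRecip_natCast, qPochRecip_natCast,
      zpow_natCast, Nat.succ_eq_add_one, qPoch_succ, ← pow_succ', mul_inv]
    field_simp [one_sub_pow_succ_ne_zero hq n]

theorem qPochRecip_eq {q : ℂ} (hq : ‖q‖ < 1) (m : ℤ) :
    qPochRecip q m = (1 - q ^ (m + 1)) * qPochRecip q (m + 1) := by
  rw [← qPochRecip_sub_one hq, add_sub_cancel_right]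

theorem tendsto_qPochRecip {q : ℂ} (hq : ‖q‖ < 1) :
    Tendsto (qPochRecip q) atTop (𝓝 (qPochInf q q)⁻¹) := by
  have h := ((tendsto_qPoch q hq).inv₀ (qPochInf_self_ne_zero hq)).comp
    (tendsto_atTop_atTop.mpr fun b : ℕ => ⟨(b : ℤ), fun m hm => by omega⟩ :
      Tendsto Int.toNat atTop atTop)
  refine h.congr' ?_
  filter_upwards [eventually_ge_atTop 0] with m hm
  simp [qPochRecip, hm]

theorem exists_norm_qPochRecip_le {q : ℂ} (hq : ‖q‖ < 1) :
    ∃ C : ℝ, 0 ≤ C ∧ ∀ m, ‖qPochRecip q m‖ ≤ C := by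
  have h := (tendsto_qPoch q hq).inv₀ (qPochInf_self_ne_zero hq)
  obtain ⟨C, hC⟩ := (Metric.isBounded_range_of_tendsto _ h).exists_norm_le
  have h0 : 0 ≤ C := (norm_nonneg _).trans (hC _ ⟨0, rfl⟩)
  refine ⟨C, h0, fun m => ?_⟩
  rw [qPochRecip]
  split_ifs
  · exact hC _ ⟨_, rfl⟩
  · simpa using h0

theorem qTri_zero (q : ℂ) : qTri q 0 = 1 := by simp [qTri]

theorem qTri_add_one {q : ℂ} (hq0 : q ≠ 0) (j : ℤ) : qTri q (j + 1) = qTri q j * q ^ j := by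
  rw [qTri, qTri, ← zpow_add₀ hq0]
  congr 1
  rw [← Int.add_mul_ediv_right _ _ two_ne_zero]
  congr 1
  ring

theorem qTri_sub_one {q : ℂ} (hq0 : q ≠ 0) (j : ℤ) :
    qTri q (j - 1) = qTri q j * (q * (q ^ j)⁻¹) := by
  have h := qTri_add_one hq0 (j - 1)
  rw [sub_add_cancel, zpow_sub₀ hq0, zpow_one] at h
  have := zpow_ne_zero j hq0
  rw [h]
  field_simp

theorem qTri_one_sub (q : ℂ) (j : ℤ) : qTri q (1 - j) = qTri q j := by
  rw [qTri, qTri]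
  congr 2
  ring

theorem qTri_sq (q : ℂ) (j : ℤ) : qTri (q ^ 2) j = q ^ (j * (j - 1)) := by
  rw [qTri, ← zpow_natCast q 2, ← zpow_mul, Nat.cast_ofNat,
    Int.mul_ediv_cancel' (Int.even_mul_pred_self j).two_dvd]

theorem qTri_ne_zero {q : ℂ} (hq0 : q ≠ 0) (j : ℤ) : qTri q j ≠ 0 := zpow_ne_zero _ hq0

theorem summable_nat_qTri {q : ℂ} (hq0 : q ≠ 0) (hq : ‖q‖ < 1) {w : ℂ} (hw : w ≠ 0) :
    Summable fun n : ℕ => ‖qTri q n * w ^ n‖ := by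
  refine (summable_of_ratio_test_tendsto_lt_one (l := 0) one_pos
    (Eventually.of_forall fun n => mul_ne_zero (qTri_ne_zero hq0 _) (pow_ne_zero _ hw)) ?_).norm
  have h : Tendsto (fun n : ℕ => ‖q‖ ^ n * ‖w‖) atTop (𝓝 (0 * ‖w‖)) :=
    (tendsto_pow_atTop_nhds_zero_of_lt_one (norm_nonneg q) hq).mul_const _
  rw [zero_mul] at h
  refine h.congr fun n => ?_
  have h1 := qTri_ne_zero hq0 n
  rw [← norm_pow, ← norm_mul, ← norm_div]
  congr 1
  rw [Nat.cast_succ, qTri_add_one hq0, zpow_natCast]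
  field_simp
  ring

theorem summable_norm_qTri {q : ℂ} (hq0 : q ≠ 0) (hq : ‖q‖ < 1) {w : ℂ} (hw : w ≠ 0) :
    Summable fun j : ℤ => ‖qTri q j * w ^ j‖ := by
  refine Summable.of_nat_of_neg (by simpa using summable_nat_qTri hq0 hq hw) ?_
  refine (summable_nat_qTri hq0 hq (mul_ne_zero hq0 (inv_ne_zero hw))).congr fun n => ?_
  rw [← qTri_one_sub q (-n), sub_neg_eq_add, add_comm, qTri_add_one hq0, mul_pow, zpow_neg,
    zpow_natCast, zpow_natCast, inv_pow]
  ring_nf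

theorem summable_qTri {q : ℂ} (hq0 : q ≠ 0) (hq : ‖q‖ < 1) {w : ℂ} (hw : w ≠ 0) :
    Summable fun j : ℤ => qTri q j * w ^ j := (summable_norm_qTri hq0 hq hw).of_norm

theorem pow_ne_neg_one {q : ℂ} (hq : ‖q‖ < 1) (n : ℕ) : 1 + q ^ n ≠ 0 := by
  rcases n with - | n
  · norm_num
  intro h
  refine one_sub_pow_succ_ne_zero hq (2 * n + 1) ?_
  rw [show 2 * n + 1 + 1 = (n + 1) * 2 by ring, pow_mul, eq_neg_of_add_eq_zero_right h]
  ring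

/-! ### Finite triple products and the Jacobi triple product -/

/-- The coefficient recurrence behind the finite triple products. -/
theorem qPochRecip_mul_succ {q : ℂ} (hq0 : q ≠ 0) (hq : ‖q‖ < 1) (n : ℕ) (j : ℤ) :
    qPochRecip q (n - j) * qPochRecip q (n + j) =
        (1 - q ^ (n + 1) * (q ^ j)⁻¹) * (1 - q ^ (n + 1) * q ^ j) *
        (qPochRecip q ((n + 1 : ℕ) - j) * qPochRecip q ((n + 1 : ℕ) + j)) ∧
      qPochRecip q (n - (j - 1)) * qPochRecip q (n + (j - 1)) =
        (1 - q ^ n * q ^ j) * (1 - q ^ (n + 1) * q ^ j) *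
        (qPochRecip q ((n + 1 : ℕ) - j) * qPochRecip q ((n + 1 : ℕ) + j)) ∧
      qPochRecip q (n - (j + 1)) * qPochRecip q (n + (j + 1)) =
        (1 - q ^ n * (q ^ j)⁻¹) * (1 - q ^ (n + 1) * (q ^ j)⁻¹) *
        (qPochRecip q ((n + 1 : ℕ) - j) * qPochRecip q ((n + 1 : ℕ) + j)) := by
  have e (a : ℤ) : qPochRecip q a = (1 - q ^ (a + 1)) * qPochRecip q (a + 1) := qPochRecip_eq hq a
  have p1 : q ^ ((n : ℤ) - j + 1) = q ^ (n + 1) * (q ^ j)⁻¹ := by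
    rw [zpow_add₀ hq0, zpow_sub₀ hq0, zpow_natCast, zpow_one, pow_succ]; ring
  have p2 : q ^ ((n : ℤ) + j + 1) = q ^ (n + 1) * q ^ j := by
    rw [zpow_add₀ hq0, zpow_add₀ hq0, zpow_natCast, zpow_one, pow_succ]; ring
  have p3 : q ^ ((n : ℤ) - j) = q ^ n * (q ^ j)⁻¹ := by
    rw [zpow_sub₀ hq0, zpow_natCast]; ring
  have p4 : q ^ ((n : ℤ) + j) = q ^ n * q ^ j := by
    rw [zpow_add₀ hq0, zpow_natCast]
  have c1 : ((n + 1 : ℕ) : ℤ) - j = n - j + 1 := by push_cast; ring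
  have c2 : ((n + 1 : ℕ) : ℤ) + j = n + j + 1 := by push_cast; ring
  have d1 : (n : ℤ) - (j - 1) = n - j + 1 := by ring
  have d2 : (n : ℤ) + (j - 1) = n + j - 1 := by ring
  have d3 : (n : ℤ) - (j + 1) = n - j - 1 := by ring
  have d4 : (n : ℤ) + (j + 1) = n + j + 1 := by ring
  rw [c1, c2, d1, d2, d3, d4, e (n + j - 1), e (n - j - 1), sub_add_cancel, sub_add_cancel,
    e (n + j), e (n - j), p1, p2, p3, p4]
  refine ⟨by ring, by ring, by ring⟩

theorem hasSum_of_eq {ι : Type*} {f g : ι → ℂ} {a b : ℂ} (h : HasSum f a) (hf : ∀ i, g i = f i)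
    (ha : b = a) : HasSum g b := by
  rw [ha, funext hf]
  exact h

theorem hasSum_shift_sub {f : ℤ → ℂ} {a : ℂ} (h : HasSum f a) (k : ℤ) :
    HasSum (fun j => f (j - k)) a :=
  (Equiv.subRight k).hasSum_iff.mpr h

theorem hasSum_shift_add {f : ℤ → ℂ} {a : ℂ} (h : HasSum f a) (k : ℤ) :
    HasSum (fun j => f (j + k)) a :=
  (Equiv.addRight k).hasSum_iff.mpr h

theorem qPochRecip_mul_zero (q : ℂ) {j : ℤ} (hj : j ≠ 0) :
    qPochRecip q ((0 : ℕ) - j) * qPochRecip q ((0 : ℕ) + j) = 0 := by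
  rcases lt_or_gt_of_ne hj with h | h
  · rw [qPochRecip_of_neg q (m := (0 : ℕ) + j) (by simpa using h), mul_zero]
  · rw [qPochRecip_of_neg q (m := (0 : ℕ) - j) (by simpa using h), zero_mul]

/-- The finite Jacobi triple product. -/
theorem hasSum_finite_triple {q : ℂ} (hq0 : q ≠ 0) (hq : ‖q‖ < 1) {w : ℂ} (hw : w ≠ 0) (n : ℕ) :
    HasSum (fun j : ℤ => qTri q j * w ^ j * (qPochRecip q (n - j) * qPochRecip q (n + j)))
      (qPoch (-w) q n * qPoch (-(q / w)) q n / qPoch q q (2 * n)) := by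
  induction n with
  | zero =>
    convert hasSum_single (0 : ℤ) fun j hj => ?_ using 1
    · simp [qPoch_zero, qTri_zero, qPochRecip_zero]
    · rw [qPochRecip_mul_zero q hj, mul_zero]
  | succ n ih =>
    have h1 := one_sub_pow_succ_ne_zero hq (2 * n)
    have h2 := one_sub_pow_succ_ne_zero hq (2 * n + 1)
    -- The new factors multiply out as (1 + wq^n)(1 + q^{n+1}/w) = (1 + q^{2n+1}) + wq^n +
    -- q^{n+1}/w; multiplying by w or 1/w shifts the summation index.
    have h := (((ih.mul_left (1 + q ^ (2 * n + 1))).add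
      ((hasSum_shift_sub ih 1).mul_left (w * q ^ n))).add
      ((hasSum_shift_add ih 1).mul_left (q ^ (n + 1) * w⁻¹))).mul_right
      ((1 - q ^ (2 * n + 1)) * (1 - q ^ (2 * n + 1 + 1)))⁻¹
    refine hasSum_of_eq h (fun j => ?_) ?_
    · obtain ⟨e1, e2, e3⟩ := qPochRecip_mul_succ hq0 hq n j
      rw [e1, e2, e3, eq_mul_inv_iff_mul_eq₀ (mul_ne_zero h1 h2), qTri_add_one hq0, qTri_sub_one hq0,
        zpow_add_one₀ hw, zpow_sub_one₀ hw]
      have := zpow_ne_zero j hq0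
      have := zpow_ne_zero j hw
      field_simp
      ring
    · have := qPoch_self_ne_zero hq (2 * n)
      rw [eq_mul_inv_iff_mul_eq₀ (mul_ne_zero h1 h2), show 2 * (n + 1) = 2 * n + 1 + 1 by ring]
      simp only [qPoch_succ, ← pow_succ']
      field_simp
      ring

/-- The finite triple product symmetric under `w ↦ w⁻¹`. -/
theorem hasSum_finite_triple_symm {q : ℂ} (hq0 : q ≠ 0) (hq : ‖q‖ < 1) {w : ℂ} (hw : w ≠ 0)
    (n : ℕ) :
    HasSum (fun j : ℤ => qTri q j * (1 + q ^ j) * w ^ j *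
        (qPochRecip q (n - j) * qPochRecip q (n + j)))
      ((1 + q ^ n) * (qPoch (-w) q n * qPoch (-w⁻¹) q n / qPoch q q (2 * n))) := by
  induction n with
  | zero =>
    convert hasSum_single (0 : ℤ) fun j hj => ?_ using 1
    · simp [qPoch_zero, qTri_zero, qPochRecip_zero]
    · rw [qPochRecip_mul_zero q hj, mul_zero]
  | succ n ih =>
    have h1 := one_sub_pow_succ_ne_zero hq (2 * n)
    have h2 := one_sub_pow_succ_ne_zero hq n
    have h3 := pow_ne_neg_one hq n
    have h4 := pow_ne_neg_one hq (n + 1)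
    -- Same expansion with (1 + wq^n)(1 + q^n/w). In the divisor, 1 + q^{n+1} has been cancelled
    -- from 1 - q^{2n+2}, and 1 + q^n removes the old normalisation.
    have h := (((ih.mul_left (1 + q ^ (2 * n))).add
      ((hasSum_shift_sub ih 1).mul_left (w * q ^ n))).add
      ((hasSum_shift_add ih 1).mul_left (q ^ n * w⁻¹))).mul_right
      ((1 - q ^ (2 * n + 1)) * (1 - q ^ (n + 1)) * (1 + q ^ n))⁻¹
    refine hasSum_of_eq h (fun j => ?_) ?_
    · obtain ⟨e1, e2, e3⟩ := qPochRecip_mul_succ hq0 hq n j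
      rw [e1, e2, e3, eq_mul_inv_iff_mul_eq₀ (mul_ne_zero (mul_ne_zero h1 h2) h3), qTri_add_one hq0,
        qTri_sub_one hq0, zpow_add_one₀ hw, zpow_sub_one₀ hw, zpow_add_one₀ hq0,
        zpow_sub_one₀ hq0]
      have := zpow_ne_zero j hq0
      have := zpow_ne_zero j hw
      field_simp
      ring
    · have := qPoch_self_ne_zero hq (2 * n)
      rw [eq_mul_inv_iff_mul_eq₀ (mul_ne_zero (mul_ne_zero h1 h2) h3),
        show 2 * (n + 1) = 2 * n + 1 + 1 by ring]
      simp only [qPoch_succ, ← pow_succ']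
      have h5 : 1 - q ^ (2 * n + 1 + 1) = (1 - q ^ (n + 1)) * (1 + q ^ (n + 1)) := by ring
      rw [h5]
      field_simp
      ring

/-- The Jacobi triple product. -/
theorem hasSum_triple {q : ℂ} (hq0 : q ≠ 0) (hq : ‖q‖ < 1) {w : ℂ} (hw : w ≠ 0) :
    HasSum (fun j : ℤ => qTri q j * w ^ j)
      (qPochInf (-w) q * qPochInf (-(q / w)) q * qPochInf q q) := by
  have hne := qPochInf_self_ne_zero hq
  obtain ⟨C, hC0, hC⟩ := exists_norm_qPochRecip_le hq
  -- Tannery's theorem on the finite identity: each pair of reciprocals is bounded by C² uniformly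
  -- in n and j, and tends to 1/(q; q)_∞².
  have hlim : Tendsto (fun n : ℕ => ∑' j : ℤ,
      qTri q j * w ^ j * (qPochRecip q (n - j) * qPochRecip q (n + j))) atTop
      (𝓝 (∑' j : ℤ, qTri q j * w ^ j * ((qPochInf q q)⁻¹ * (qPochInf q q)⁻¹))) := by
    refine tendsto_tsum_of_dominated_convergence
      (bound := fun j : ℤ => ‖qTri q j * w ^ j‖ * (C * C))
      ((summable_norm_qTri hq0 hq hw).mul_right _) (fun j => ?_)
      (Eventually.of_forall fun n j => ?_)
    · refine ((((tendsto_qPochRecip hq).comp ?_).mul ((tendsto_qPochRecip hq).comp ?_)).const_mul _)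
      · exact (tendsto_atTop_add_const_right _ (-j) tendsto_natCast_atTop_atTop)
      · exact (tendsto_atTop_add_const_right _ j tendsto_natCast_atTop_atTop)
    · rw [norm_mul, norm_mul (qPochRecip _ _)]
      gcongr <;> exact hC _
  have h2 : Tendsto (fun n : ℕ => 2 * n) atTop atTop := by
    exact tendsto_id.const_mul_atTop' two_pos
  have hlim2 := ((tendsto_qPoch (-w) hq).mul (tendsto_qPoch (-(q / w)) hq)).div
    ((tendsto_qPoch q hq).comp h2) hne
  have huniq := tendsto_nhds_unique hlim
    (hlim2.congr fun n => (hasSum_finite_triple hq0 hq hw n).tsum_eq.symm)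
  rw [tsum_mul_right] at huniq
  convert (summable_qTri hq0 hq hw).hasSum using 1
  field_simp at huniq
  rw [huniq]
  ring

/-! ### The Durfee rectangle identity -/

/-- The summand of the bilateral Cauchy (Durfee rectangle) sum. -/
noncomputable def durfeeTerm (q : ℂ) (k m : ℤ) : ℂ :=
  q ^ (m * (m + k)) * (qPochRecip q m * qPochRecip q (m + k))

theorem norm_sq_lt_one {q : ℂ} (hq : ‖q‖ < 1) : ‖q ^ 2‖ < 1 := by
  rw [norm_pow]
  exact pow_lt_one₀ (norm_nonneg q) hq two_ne_zero

theorem zpow_quadratic {q : ℂ} (hq0 : q ≠ 0) (k m : ℤ) :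
    q ^ (m * (m + k)) = qTri (q ^ 2) m * (q ^ (k + 1)) ^ m := by
  rw [qTri_sq, ← zpow_mul, ← zpow_add₀ hq0]
  congr 1
  ring

theorem summable_durfeeTerm {q : ℂ} (hq0 : q ≠ 0) (hq : ‖q‖ < 1) (k : ℤ) :
    Summable (durfeeTerm q k) := by
  obtain ⟨C, hC0, hC⟩ := exists_norm_qPochRecip_le hq
  refine Summable.of_norm_bounded (g := fun m : ℤ => ‖qTri (q ^ 2) m * (q ^ (k + 1)) ^ m‖ * (C * C))
    ((summable_norm_qTri (pow_ne_zero 2 hq0) (norm_sq_lt_one hq)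
      (zpow_ne_zero _ hq0)).mul_right _) fun m => ?_
  rw [durfeeTerm, norm_mul, norm_mul (qPochRecip _ _), zpow_quadratic hq0]
  gcongr <;> exact hC _

/-- Termwise after one shift: the summand of S_k - S_{k+1} + q^{k+1} S_{k+1} at m + 1 is q^{k+1}
times the summand of S_{k+2} at m. -/
theorem tsum_durfeeTerm_rec {q : ℂ} (hq0 : q ≠ 0) (hq : ‖q‖ < 1) (k : ℤ) :
    ∑' m, durfeeTerm q k m - ∑' m, durfeeTerm q (k + 1) m =
      -q ^ (k + 1) * (∑' m, durfeeTerm q (k + 1) m - ∑' m, durfeeTerm q (k + 2) m) := by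
  have h0 := (summable_durfeeTerm hq0 hq k).hasSum
  have h1 := (summable_durfeeTerm hq0 hq (k + 1)).hasSum
  have h2 := (summable_durfeeTerm hq0 hq (k + 2)).hasSum
  have h3 := hasSum_shift_add ((h0.sub h1).add (h1.mul_left (q ^ (k + 1)))) 1
  have h4 := h3.unique (hasSum_of_eq (h2.mul_left (q ^ (k + 1))) (fun m => ?_) rfl)
  · linear_combination h4
  · have e (a : ℤ) : qPochRecip q a = (1 - q ^ (a + 1)) * qPochRecip q (a + 1) :=
      qPochRecip_eq hq a
    simp only [durfeeTerm]
    rw [show m + 1 + (k + 1) = m + (k + 2) by ring, show m + 1 + k = m + k + 1 by ring,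
      e (m + k + 1), e m, show m + k + 1 + 1 = m + (k + 2) by ring]
    have x1 : q ^ ((m + 1) * (m + k + 1)) = q ^ (m * m) * q ^ (m * k) * q ^ m * q ^ m * q ^ k * q := by
      rw [← zpow_add₀ hq0, ← zpow_add₀ hq0, ← zpow_add₀ hq0, ← zpow_add₀ hq0, ← zpow_add_one₀ hq0]
      congr 1; ring
    have x2 : q ^ ((m + 1) * (m + (k + 2))) =
        q ^ (m * m) * q ^ (m * k) * q ^ m * q ^ m * q ^ m * q ^ k * q * q := by
      rw [← zpow_add₀ hq0, ← zpow_add₀ hq0, ← zpow_add₀ hq0, ← zpow_add₀ hq0, ← zpow_add₀ hq0,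
        ← zpow_add_one₀ hq0, ← zpow_add_one₀ hq0]
      congr 1; ring
    have x3 : q ^ (m * (m + (k + 2))) = q ^ (m * m) * q ^ (m * k) * q ^ m * q ^ m := by
      rw [← zpow_add₀ hq0, ← zpow_add₀ hq0, ← zpow_add₀ hq0]
      congr 1; ring
    have x4 : q ^ (m + (k + 2)) = q ^ m * q ^ k * q * q := by
      rw [← zpow_add₀ hq0, ← zpow_add_one₀ hq0, ← zpow_add_one₀ hq0]
      congr 1; ring
    rw [x1, x2, x3, x4, zpow_add_one₀ hq0, zpow_add_one₀ hq0]
    ring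

/-- Only m = 0 survives in the limit: negative m contribute zero, and positive m carry a factor of
size at most |q|^k. -/
theorem tendsto_tsum_durfeeTerm {q : ℂ} (hq0 : q ≠ 0) (hq : ‖q‖ < 1) :
    Tendsto (fun k : ℕ => ∑' m, durfeeTerm q k m) atTop (𝓝 (qPochInf q q)⁻¹) := by
  obtain ⟨C, hC0, hC⟩ := exists_norm_qPochRecip_le hq
  rw [← tsum_ite_eq (0 : ℤ) fun _ => (qPochInf q q)⁻¹]
  refine tendsto_tsum_of_dominated_convergence
    (bound := fun m : ℤ => ‖qTri (q ^ 2) m * q ^ m‖ * (C * C))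
    ((summable_norm_qTri (pow_ne_zero 2 hq0) (norm_sq_lt_one hq) hq0).mul_right _) (fun m => ?_)
    (Eventually.of_forall fun k m => ?_)
  · rcases lt_trichotomy m 0 with h | rfl | h
    · simp [durfeeTerm, qPochRecip_of_neg q h, h.ne]
    · have h : Tendsto (fun k : ℕ => qPochRecip q k) atTop (𝓝 (qPochInf q q)⁻¹) :=
        (tendsto_qPochRecip hq).comp tendsto_natCast_atTop_atTop
      simpa [durfeeTerm, qPochRecip_zero] using h
    · rw [if_neg h.ne']
      refine squeeze_zero_norm (a := fun k : ℕ => ‖q‖ ^ k * (C * C)) (fun k => ?_) ?_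
      · rw [durfeeTerm, norm_mul, norm_mul (qPochRecip _ _)]
        gcongr
        · rw [norm_zpow, ← zpow_natCast]
          exact zpow_le_zpow_right_of_le_one₀ (norm_pos_iff.mpr hq0) hq.le (by nlinarith)
        · exact hC _
        · exact hC _
      · simpa using (tendsto_pow_atTop_nhds_zero_of_lt_one (norm_nonneg q) hq).mul_const (C * C)
  · rcases lt_or_ge m 0 with h | h
    · rw [durfeeTerm, qPochRecip_of_neg q h, zero_mul, mul_zero, norm_zero]
      positivity
    · rw [durfeeTerm, norm_mul, norm_mul (qPochRecip _ _)]
      gcongr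
      · rw [qTri_sq, ← zpow_add₀ hq0, norm_zpow, norm_zpow]
        exact zpow_le_zpow_right_of_le_one₀ (norm_pos_iff.mpr hq0) hq.le (by nlinarith)
      · exact hC _
      · exact hC _

/-- For k ≥ 0 the consecutive differences are nondecreasing in norm, since |q^{k+1}| ≤ 1, yet tend
to 0; hence they vanish. The recurrence carries this down to negative k. -/
theorem tsum_durfeeTerm_succ {q : ℂ} (hq0 : q ≠ 0) (hq : ‖q‖ < 1) (k : ℤ) :
    ∑' m, durfeeTerm q k m = ∑' m, durfeeTerm q (k + 1) m := by
  have hnat (k : ℕ) : ∑' m, durfeeTerm q k m - ∑' m, durfeeTerm q (k + 1) m = 0 := by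
    have hmono : Monotone fun k : ℕ =>
        ‖∑' m, durfeeTerm q k m - ∑' m, durfeeTerm q (k + 1) m‖ := by
      refine monotone_nat_of_le_succ fun n => ?_
      rw [tsum_durfeeTerm_rec hq0 hq, norm_mul, norm_neg, Nat.cast_succ, add_assoc, one_add_one_eq_two]
      refine mul_le_of_le_one_left (norm_nonneg _) ?_
      rw [← Nat.cast_succ, zpow_natCast, norm_pow]
      exact pow_le_one₀ (norm_nonneg _) hq.le
    have ht := tendsto_tsum_durfeeTerm hq0 hq
    have hlim := (ht.sub (ht.comp (tendsto_add_atTop_nat 1))).norm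
    rw [sub_self, norm_zero] at hlim
    have := hmono.ge_of_tendsto (hlim.congr fun n => by simp) k
    exact norm_le_zero_iff.mp this
  induction k using Int.induction_on with
  | zero => exact sub_eq_zero.mp (hnat 0)
  | succ i _ => simpa using sub_eq_zero.mp (hnat (i + 1))
  | pred i ih =>
    rw [← sub_eq_zero, tsum_durfeeTerm_rec hq0 hq, show -(i : ℤ) - 1 + 2 = -i + 1 by ring,
      sub_add_cancel, ih, sub_self, mul_zero]

theorem tsum_durfeeTerm {q : ℂ} (hq0 : q ≠ 0) (hq : ‖q‖ < 1) (k : ℤ) :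
    ∑' m, durfeeTerm q k m = (qPochInf q q)⁻¹ := by
  have hconst (k : ℤ) : ∑' m, durfeeTerm q k m = ∑' m, durfeeTerm q 0 m := by
    induction k using Int.induction_on with
    | zero => rfl
    | succ i ih => rw [← tsum_durfeeTerm_succ hq0 hq, ih]
    | pred i ih => rw [tsum_durfeeTerm_succ hq0 hq, sub_add_cancel, ih]
  have h := tendsto_tsum_durfeeTerm hq0 hq
  simp only [hconst (_ : ℕ)] at h
  rw [hconst, tendsto_nhds_unique h tendsto_const_nhds]

/-! ### The quintuple product identity -/

/-- The power `q ^ (j (3 j - 1) / 2)` with generalised pentagonal exponent. -/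
noncomputable def qPent (q : ℂ) (j : ℤ) : ℂ := qTri (q ^ 3) j * q ^ j

theorem qTri_pow (q : ℂ) (j : ℤ) (n : ℕ) : qTri (q ^ n) j = qTri q j ^ n := by
  rw [qTri, qTri, ← zpow_natCast, ← zpow_natCast, zpow_comm]

theorem qPent_eq {q : ℂ} (hq0 : q ≠ 0) (j : ℤ) : qPent q j = qTri q j * q ^ (j * j) := by
  have h : q ^ (j * j) = qTri q j ^ 2 * q ^ j := by
    rw [← qTri_pow, qTri_sq, ← zpow_add₀ hq0]
    congr 1
    ring
  rw [qPent, h, qTri_pow]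
  ring

theorem qPent_zero (q : ℂ) : qPent q 0 = 1 := by simp [qPent, qTri_zero]

theorem qPent_add_one {q : ℂ} (hq0 : q ≠ 0) (j : ℤ) :
    qPent q (j + 1) = qPent q j * (q ^ j) ^ 3 * q := by
  rw [qPent, qPent, qTri_add_one (pow_ne_zero 3 hq0), zpow_add_one₀ hq0,
    ← zpow_natCast q 3, ← zpow_natCast (q ^ j) 3, zpow_comm]
  ring

/-- A two-sided first-order recurrence determines the sequence. -/
theorem eq_of_int_recurrence {f g c : ℤ → ℂ} (hc : ∀ j, c j ≠ 0)
    (hf : ∀ j, f (j + 1) = c j * f j) (hg : ∀ j, g (j + 1) = c j * g j) (h0 : f 0 = g 0) (j : ℤ) :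
    f j = g j := by
  induction j using Int.induction_on with
  | zero => exact h0
  | succ i ih => rw [hf, hg, ih]
  | pred i ih =>
    have h1 := hf (-i - 1)
    have h2 := hg (-i - 1)
    rw [sub_add_cancel] at h1 h2
    exact mul_left_cancel₀ (hc _) (by rw [← h1, ← h2, ih])

theorem norm_pow_lt_one {q : ℂ} (hq : ‖q‖ < 1) {n : ℕ} (hn : n ≠ 0) : ‖q ^ n‖ < 1 := by
  rw [norm_pow]
  exact pow_lt_one₀ (norm_nonneg q) hq hn

theorem qPochInf_eq_one_sub_mul (a : ℂ) {q : ℂ} (hq : ‖q‖ < 1) :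
    qPochInf a q = (1 - a) * qPochInf (a * q) q := by
  have h1 := (tendsto_qPoch (a * q) hq).const_mul (1 - a)
  refine tendsto_nhds_unique ((tendsto_qPoch a hq).comp (tendsto_add_atTop_nat 1))
    (h1.congr fun n => ?_)
  simp only [Function.comp, qPoch, Finset.prod_range_succ', pow_zero, mul_one, pow_succ']
  rw [mul_comm]
  simp only [mul_assoc]

theorem qPochInf_trisect (a : ℂ) {p : ℂ} (hp : ‖p‖ < 1) :
    qPochInf a p =
      qPochInf a (p ^ 3) * qPochInf (a * p) (p ^ 3) * qPochInf (a * p ^ 2) (p ^ 3) := by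
  have hp3 := norm_pow_lt_one hp three_ne_zero
  have h3 : Tendsto (fun n : ℕ => 3 * n) atTop atTop := tendsto_id.const_mul_atTop' three_pos
  refine tendsto_nhds_unique ((tendsto_qPoch a hp).comp h3)
    ((((tendsto_qPoch a hp3).mul (tendsto_qPoch (a * p) hp3)).mul
      (tendsto_qPoch (a * p ^ 2) hp3)).congr fun n => ?_)
  induction n with
  | zero => simp [qPoch_zero]
  | succ n ih =>
    simp only [Function.comp] at ih ⊢
    rw [show 3 * (n + 1) = 3 * n + 1 + 1 + 1 by ring]
    simp only [qPoch_succ, ← ih]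
    ring

/-- The summand of the inner sum in the product of two triple products. -/
noncomputable def quintTerm (q : ℂ) (l m : ℤ) : ℂ :=
  qTri q (l - 2 * m) * ((-1) ^ m * q ^ (m * m))

/-- The substitution m ↦ m + 1 shows that the coefficients of z^l, up to sign, are determined by the
residue of l mod 3. So only l = 0, 1, 2 need evaluating. -/
theorem tsum_quintTerm_add_three {q : ℂ} (hq0 : q ≠ 0) (l : ℤ) :
    ∑' m, quintTerm q (l + 3) m = -q ^ (l + 1) * ∑' m, quintTerm q l m := by
  rw [← (Equiv.addRight (1 : ℤ)).tsum_eq, ← tsum_mul_left]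
  refine tsum_congr fun m => ?_
  rw [Equiv.coe_addRight, quintTerm, quintTerm,
    show l + 3 - 2 * (m + 1) = l - 2 * m + 1 by ring, qTri_add_one hq0,
    zpow_add_one₀ (neg_ne_zero.mpr one_ne_zero)]
  have h : q ^ (l - 2 * m) * q ^ ((m + 1) * (m + 1)) = q ^ (l + 1) * q ^ (m * m) := by
    rw [← zpow_add₀ hq0, ← zpow_add₀ hq0]
    congr 1
    ring
  linear_combination (-qTri q (l - 2 * m) * (-1) ^ m) * h

theorem tsum_quintTerm_one (q : ℂ) : ∑' m, quintTerm q 1 m = ∑' m, quintTerm q 0 m := by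
  rw [← (Equiv.neg ℤ).tsum_eq]
  refine tsum_congr fun m => ?_
  rw [Equiv.neg_apply, quintTerm, quintTerm, ← qTri_one_sub q (0 - 2 * m), neg_mul_neg, zpow_neg,
    ← inv_zpow, inv_neg_one]
  congr 2
  ring

/-- The involution m ↦ 1 - m reverses the sign of the summand. -/
theorem tsum_quintTerm_two {q : ℂ} (hq0 : q ≠ 0) : ∑' m, quintTerm q 2 m = 0 := by
  have h : ∑' m, quintTerm q 2 m = -∑' m, quintTerm q 2 m := by
    conv_lhs => rw [← (Equiv.subLeft (1 : ℤ)).tsum_eq]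
    rw [← tsum_neg]
    refine tsum_congr fun m => ?_
    rw [Equiv.subLeft_apply, quintTerm, quintTerm, ← qTri_one_sub q (2 - 2 * m),
      show 2 - 2 * (1 - m) = (1 - (2 - 2 * m)) + 1 by ring, qTri_add_one hq0,
      zpow_sub₀ (neg_ne_zero.mpr (one_ne_zero (α := ℂ))), zpow_one]
    have h : q ^ (1 - (2 - 2 * m)) * q ^ ((1 - m) * (1 - m)) = q ^ (m * m) := by
      rw [← zpow_add₀ hq0]
      congr 1
      ring
    have h1 : ((-1 : ℂ) ^ m)⁻¹ = (-1) ^ m := by rw [← inv_zpow, inv_neg_one]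
    rw [div_eq_mul_inv, h1]
    linear_combination (-qTri q (1 - (2 - 2 * m)) * (-1) ^ m) * h
  linear_combination h / 2

/-- The exponent is 3m² + m = 3m(m - 1) + 4m, so this is a triple product in base q⁶ at -q⁴. Its
three factors are the residue classes mod 3 of (q²; q²)_∞. -/
theorem tsum_quintTerm_zero {q : ℂ} (hq0 : q ≠ 0) (hq : ‖q‖ < 1) :
    ∑' m, quintTerm q 0 m = qPochInf (q ^ 2) (q ^ 2) := by
  have h := hasSum_triple (pow_ne_zero 6 hq0) (norm_pow_lt_one hq (n := 6) (by norm_num))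
    (w := -q ^ 4) (neg_ne_zero.mpr (pow_ne_zero 4 hq0))
  have h6 : q ^ 6 = (q ^ 2) ^ 3 := by ring
  rw [qPochInf_trisect _ (norm_sq_lt_one hq), ← h6]
  have e1 : -(q ^ 6 / -q ^ 4) = q ^ 2 := by field_simp
  rw [e1, neg_neg] at h
  rw [show q ^ 2 * q ^ 2 = q ^ 4 by ring, show q ^ 2 * (q ^ 2) ^ 2 = q ^ 6 by ring,
    mul_comm (qPochInf (q ^ 2) _), ← h.tsum_eq]
  refine tsum_congr fun m => ?_
  rw [quintTerm, show q ^ 6 = (q ^ 3) ^ 2 by ring, qTri_sq, qTri,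
    show (0 - 2 * m) * (0 - 2 * m - 1) / 2 = m * (2 * m + 1) from
      Int.ediv_eq_of_eq_mul_left two_ne_zero (by ring), neg_eq_neg_one_mul (q ^ 4), mul_zpow,
    ← zpow_natCast q 3, ← zpow_natCast q 4, ← zpow_mul, ← zpow_mul]
  have h2 : q ^ (m * (2 * m + 1)) * q ^ (m * m) =
      q ^ (((3 : ℕ) : ℤ) * (m * (m - 1))) * q ^ (((4 : ℕ) : ℤ) * m) := by
    rw [← zpow_add₀ hq0, ← zpow_add₀ hq0]
    congr 1
    push_cast
    ring
  linear_combination (-1) ^ m * h2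

theorem tsum_quintTerm_three_mul {q : ℂ} (hq0 : q ≠ 0) (j : ℤ) :
    ∑' m, quintTerm q (3 * j) m = (-1) ^ j * qPent q j * ∑' m, quintTerm q 0 m := by
  refine eq_of_int_recurrence (f := fun j => ∑' m, quintTerm q (3 * j) m)
    (g := fun j => (-1) ^ j * qPent q j * ∑' m, quintTerm q 0 m) (c := fun j => -q ^ (3 * j + 1))
    (fun j => neg_ne_zero.mpr (zpow_ne_zero _ hq0)) (fun j => ?_) (fun j => ?_) ?_ j
  · simp only [mul_add, mul_one, tsum_quintTerm_add_three hq0]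
  · simp only [qPent_add_one hq0, zpow_add_one₀ (neg_ne_zero.mpr (one_ne_zero (α := ℂ))),
      zpow_add_one₀ hq0, mul_comm (3 : ℤ), zpow_mul, zpow_ofNat]
    ring
  · simp [qPent_zero]

theorem tsum_quintTerm_three_mul_add_one {q : ℂ} (hq0 : q ≠ 0) (j : ℤ) :
    ∑' m, quintTerm q (3 * j + 1) m =
      (-1) ^ j * (qPent q j * q ^ j) * ∑' m, quintTerm q 0 m := by
  refine eq_of_int_recurrence (f := fun j => ∑' m, quintTerm q (3 * j + 1) m)
    (g := fun j => (-1) ^ j * (qPent q j * q ^ j) * ∑' m, quintTerm q 0 m)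
    (c := fun j => -q ^ (3 * j + 1 + 1))
    (fun j => neg_ne_zero.mpr (zpow_ne_zero _ hq0)) (fun j => ?_) (fun j => ?_) ?_ j
  · simp only [mul_add, mul_one]
    rw [add_right_comm, tsum_quintTerm_add_three hq0]
  · simp only [qPent_add_one hq0, zpow_add_one₀ (neg_ne_zero.mpr (one_ne_zero (α := ℂ))),
      zpow_add_one₀ hq0, mul_comm (3 : ℤ), zpow_mul, zpow_ofNat]
    ring
  · simp [qPent_zero, tsum_quintTerm_one]

theorem tsum_quintTerm_three_mul_add_two {q : ℂ} (hq0 : q ≠ 0) (j : ℤ) :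
    ∑' m, quintTerm q (3 * j + 2) m = 0 := by
  refine eq_of_int_recurrence (f := fun j => ∑' m, quintTerm q (3 * j + 2) m)
    (g := fun _ => 0) (c := fun j => -q ^ (3 * j + 2 + 1))
    (fun j => neg_ne_zero.mpr (zpow_ne_zero _ hq0)) (fun j => ?_) (fun j => ?_) ?_ j
  · simp only [mul_add, mul_one]
    rw [add_right_comm, tsum_quintTerm_add_three hq0]
  · simp
  · simp [tsum_quintTerm_two hq0]

theorem hasSum_trisect {f : ℤ → ℂ} {a : ℂ} (h : HasSum f a) :
    HasSum (fun j => f (3 * j) + f (3 * j + 1) + f (3 * j + 2)) a := by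
  have h1 : HasSum (f ∘ (Int.divModEquiv 3).symm) a := (Int.divModEquiv 3).symm.hasSum_iff.mpr h
  have h2 := h1.prod_fiberwise fun j => hasSum_fintype _
  refine hasSum_of_eq h2 (fun j => ?_) rfl
  rw [Fin.sum_univ_three]
  simp [Int.divModEquiv, mul_comm]

/-- The equivalence `(l, m) ↦ (l - 2 m, m)`. -/
def shearEquiv : ℤ × ℤ ≃ ℤ × ℤ where
  toFun p := (p.1 - 2 * p.2, p.2)
  invFun p := (p.1 + 2 * p.2, p.2)
  left_inv p := by simp
  right_inv p := by simp

theorem triple_mul_triple_term {q z : ℂ} (hq0 : q ≠ 0) (hz : z ≠ 0) (l m : ℤ) :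
    qTri q (l - 2 * m) * (-z) ^ (l - 2 * m) * (qTri (q ^ 2) m * (-(q * z ^ 2)) ^ m) =
      (-z) ^ l * quintTerm q l m := by
  have h1 : q ^ (m * m) = q ^ (m * (m - 1)) * q ^ m := by
    rw [← zpow_add₀ hq0]
    congr 1
    ring
  have h2 : (-z) ^ (l - 2 * m) * (-(q * z ^ 2)) ^ m = (-z) ^ l * ((-1) ^ m * q ^ m) := by
    have h3 : -(q * z ^ 2) = (-z) ^ 2 * (-1 * q) := by ring
    rw [h3, mul_zpow, mul_zpow, ← mul_assoc, ← zpow_natCast (-z) 2, ← zpow_mul,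
      ← zpow_add₀ (neg_ne_zero.mpr hz), Nat.cast_ofNat, sub_add_cancel]
  rw [qTri_sq, quintTerm, h1]
  linear_combination (qTri q (l - 2 * m) * q ^ (m * (m - 1))) * h2

/-- Summing a product of two bilateral series along the shear `(l, m) ↦ (l - 2 m, m)`. -/
theorem hasSum_shear {f : ℤ × ℤ → ℂ} {c : ℤ → ℂ} {g : ℤ → ℤ → ℂ} {a : ℂ} (hf : HasSum f a)
    (h : ∀ l m, c l * g l m = f (l - 2 * m, m)) :
    HasSum (fun l : ℤ => c l * ∑' m, g l m) a := by
  have hS : HasSum (fun p : ℤ × ℤ => c p.1 * g p.1 p.2) a :=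
    hasSum_of_eq (shearEquiv.hasSum_iff.mpr hf) (fun p => h p.1 p.2) rfl
  refine hS.prod_fiberwise fun l => ?_
  rw [← tsum_mul_left]
  exact (hS.summable.prod_factor l).hasSum

/-- The product of two triple products, collected by powers of `z`. -/
theorem hasSum_triple_mul_triple {q z : ℂ} (hq0 : q ≠ 0) (hq : ‖q‖ < 1) (hz : z ≠ 0) :
    HasSum (fun l : ℤ => (-z) ^ l * ∑' m, quintTerm q l m)
      (qPochInf (- -z) q * qPochInf (-(q / -z)) q * qPochInf q q *
        (qPochInf (- -(q * z ^ 2)) (q ^ 2) * qPochInf (-(q ^ 2 / -(q * z ^ 2))) (q ^ 2) *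
          qPochInf (q ^ 2) (q ^ 2))) := by
  have hq2 := norm_sq_lt_one hq
  have hw : -(q * z ^ 2) ≠ 0 := neg_ne_zero.mpr (mul_ne_zero hq0 (pow_ne_zero 2 hz))
  have hF := hasSum_triple hq0 hq (neg_ne_zero.mpr hz)
  have hG := hasSum_triple (pow_ne_zero 2 hq0) hq2 hw
  have hs := summable_mul_of_summable_norm
    (summable_norm_qTri hq0 hq (neg_ne_zero.mpr hz))
    (summable_norm_qTri (pow_ne_zero 2 hq0) hq2 hw)
  have hFG := hF.mul hG hs
  exact hasSum_shear hFG fun l m => (triple_mul_triple_term hq0 hz l m).symm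

/-- The quintuple product identity. -/
theorem hasSum_quintuple {q : ℂ} (hq0 : q ≠ 0) (hq : ‖q‖ < 1) {z : ℂ} (hz : z ≠ 0) :
    HasSum (fun j : ℤ => qPent q j * (z ^ 3) ^ j - z * (qPent q j * q ^ j * (z ^ 3) ^ j))
      ((1 - z) * qPochInf q q * (qPochInf (z * q) q * qPochInf (q / z) q *
        (qPochInf (q * z ^ 2) (q ^ 2) * qPochInf (q / z ^ 2) (q ^ 2)))) := by
  have hP : qPochInf (q ^ 2) (q ^ 2) ≠ 0 := qPochInf_self_ne_zero (norm_sq_lt_one hq)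
  -- The class l ≡ 2 mod 3 drops out and the other two give the two series; dividing by (q²; q²)_∞
  -- removes their common constant.
  have h3 := (hasSum_trisect (hasSum_triple_mul_triple hq0 hq hz)).mul_right
    (qPochInf (q ^ 2) (q ^ 2))⁻¹
  have hz' : -z ≠ 0 := neg_ne_zero.mpr hz
  refine hasSum_of_eq h3 (fun j => ?_) ?_
  · rw [tsum_quintTerm_three_mul hq0, tsum_quintTerm_three_mul_add_one hq0,
      tsum_quintTerm_three_mul_add_two hq0, tsum_quintTerm_zero hq0 hq,
      zpow_add_one₀ hz', zpow_mul (-z), zpow_ofNat, show (-z) ^ 3 = -1 * z ^ 3 by ring, mul_zpow,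
      eq_mul_inv_iff_mul_eq₀ hP]
    have h4 : (-1 : ℂ) ^ j * (-1) ^ j = 1 := by
      rw [← mul_zpow, neg_mul_neg, one_mul, one_zpow]
    linear_combination
      (-(z ^ 3) ^ j * qPent q j * (1 - z * q ^ j) * qPochInf (q ^ 2) (q ^ 2)) * h4
  · have e1 : -(q / -z) = q / z := by rw [div_neg, neg_neg]
    have e2 : -(q ^ 2 / -(q * z ^ 2)) = q / z ^ 2 := by field_simp
    rw [neg_neg, neg_neg, qPochInf_eq_one_sub_mul z hq, e1, e2, eq_mul_inv_iff_mul_eq₀ hP]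
    ring

/-! ### The row sums and their generating function -/

theorem qTri_mul_zpow {q : ℂ} (j : ℤ) (w : ℂ) :
    qTri q j * q ^ j * w ^ j = qTri q j * (q * w) ^ j := by
  rw [mul_zpow, mul_assoc]

/-- The common weight of the two sums `∑ n, q ^ (n ^ 2) / (1 + q ^ n) * …` below. -/
noncomputable def rowTerm (q : ℂ) (j : ℤ) (n : ℕ) : ℂ :=
  q ^ (n ^ 2) * (1 + q ^ n)⁻¹ * (qPochRecip q (n - j) * qPochRecip q (n + j))

/-- Uniformity in j is what makes the double series in `hasSum_lhs` absolutely summable. -/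
theorem exists_norm_rowTerm_le {q : ℂ} (hq : ‖q‖ < 1) :
    ∃ M : ℝ, 0 ≤ M ∧ ∀ j n, ‖rowTerm q j n‖ ≤ M * ‖q‖ ^ n := by
  obtain ⟨C, hC0, hC⟩ := exists_norm_qPochRecip_le hq
  have h1 : Tendsto (fun n : ℕ => (1 + q ^ n)⁻¹) atTop (𝓝 (1 + 0)⁻¹) :=
    ((tendsto_pow_atTop_nhds_zero_of_norm_lt_one hq).const_add 1).inv₀ (by simp)
  obtain ⟨K, hK⟩ := (Metric.isBounded_range_of_tendsto _ h1).exists_norm_le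
  have hK0 : 0 ≤ K := (norm_nonneg _).trans (hK _ ⟨0, rfl⟩)
  refine ⟨K * (C * C), by positivity, fun j n => ?_⟩
  have h2 : ‖q ^ (n ^ 2)‖ ≤ ‖q‖ ^ n := by
    rw [norm_pow]
    exact pow_le_pow_of_le_one (norm_nonneg q) hq.le (Nat.le_self_pow two_ne_zero n)
  rw [rowTerm, norm_mul, norm_mul, norm_mul (qPochRecip _ _)]
  calc _ ≤ ‖q‖ ^ n * K * (C * C) := by
        gcongr
        · exact hK _ ⟨n, rfl⟩
        · exact hC _
        · exact hC _
    _ = K * (C * C) * ‖q‖ ^ n := by ring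

theorem summable_rowTerm {q : ℂ} (hq : ‖q‖ < 1) (j : ℤ) : Summable (rowTerm q j) := by
  obtain ⟨M, -, hM⟩ := exists_norm_rowTerm_le hq
  exact Summable.of_norm_bounded
    ((summable_geometric_of_lt_one (norm_nonneg q) hq).mul_left M) (hM j)

theorem norm_rowTerm_mul_pow_le {q : ℂ} (hq : ‖q‖ < 1) (j : ℤ) (n : ℕ) :
    ‖rowTerm q j n * q ^ n‖ ≤ ‖rowTerm q j n‖ := by
  rw [norm_mul, norm_pow]
  exact mul_le_of_le_one_right (norm_nonneg _) (pow_le_one₀ (norm_nonneg q) hq.le)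

theorem summable_rowTerm_mul_pow {q : ℂ} (hq : ‖q‖ < 1) (j : ℤ) :
    Summable fun n => rowTerm q j n * q ^ n :=
  Summable.of_norm_bounded (summable_rowTerm hq j).norm (norm_rowTerm_mul_pow_le hq j)

/-- The coefficient of `w ^ j` in `∑ n, (-w, -1/w; q)_n q ^ (n ^ 2 + n) / (q; q)_{2n}`. -/
noncomputable def rowSum (q : ℂ) (j : ℤ) : ℂ :=
  qTri q j * (1 + q ^ j) * ∑' n, rowTerm q j n * q ^ n

/-- A bilateral Durfee sum with vanishing negative part, as a sum over `ℕ`. -/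
theorem hasSum_nat_durfee {q : ℂ} (hq0 : q ≠ 0) (hq : ‖q‖ < 1) {j k : ℤ}
    (hneg : ∀ n < 0, n - j < 0 ∨ n - j + k < 0) :
    HasSum (fun n : ℕ => durfeeTerm q k (n - j)) (qPochInf q q)⁻¹ := by
  have h := hasSum_shift_sub (summable_durfeeTerm hq0 hq k).hasSum j
  rw [tsum_durfeeTerm hq0 hq] at h
  refine (Nat.cast_injective (R := ℤ).hasSum_iff fun n hn => ?_).mpr h
  have hn0 : n < 0 := by
    by_contra! h0
    exact hn ⟨n.toNat, Int.toNat_of_nonneg h0⟩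
  rcases hneg n hn0 with h | h
  · simp [durfeeTerm, qPochRecip_of_neg q h]
  · simp [durfeeTerm, qPochRecip_of_neg q h]

/-- The factor 1 + q^n cancels, and n² = j² + (n - j)(n + j) turns the rest into a Durfee sum. -/
theorem tsum_rowTerm_add {q : ℂ} (hq0 : q ≠ 0) (hq : ‖q‖ < 1) (j : ℤ) :
    ∑' n, rowTerm q j n + ∑' n, rowTerm q j n * q ^ n = q ^ (j * j) * (qPochInf q q)⁻¹ := by
  -- For n < 0 the indices n - j and n + j have negative sum, so one of them is negative.
  have h := (hasSum_nat_durfee hq0 hq (j := j) (k := 2 * j) (by omega)).mul_left (q ^ (j * j))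
  refine ((summable_rowTerm hq j).hasSum.add (summable_rowTerm_mul_pow hq j).hasSum).unique
    (hasSum_of_eq h (fun n => ?_) rfl)
  have h1 := pow_ne_neg_one hq n
  have h2 : q ^ (n ^ 2) = q ^ (j * j) * q ^ (((n : ℤ) - j) * (n - j + 2 * j)) := by
    rw [← zpow_add₀ hq0, ← zpow_natCast]
    congr 1
    push_cast
    ring
  rw [rowTerm, durfeeTerm, h2, show (n : ℤ) - j + 2 * j = n + j by ring]
  field_simp

/-- The combination is chosen so that 1 + q^n cancels: q^j(1 + q^{j+1})(1 - q^{n-j}) - (1 + q^j)(1 -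
q^{n+j+1}) = -(1 - q^{2j+1})(1 + q^n). -/
theorem tsum_rowTerm_mul_pow_rec {q : ℂ} (hq0 : q ≠ 0) (hq : ‖q‖ < 1) (j : ℤ) :
    q ^ j * (1 + q ^ (j + 1)) * ∑' n, rowTerm q (j + 1) n * q ^ n -
      (1 + q ^ j) * ∑' n, rowTerm q j n * q ^ n =
      -(1 - q ^ (2 * j + 1)) * q ^ (j * j + j) * (qPochInf q q)⁻¹ := by
  have h := (hasSum_nat_durfee hq0 hq (j := j) (k := 2 * j + 1) (by omega)).mul_left
    (-(1 - q ^ (2 * j + 1)) * q ^ (j * j + j))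
  refine (((summable_rowTerm_mul_pow hq (j + 1)).hasSum.mul_left (q ^ j * (1 + q ^ (j + 1)))).sub
    ((summable_rowTerm_mul_pow hq j).hasSum.mul_left (1 + q ^ j))).unique
    (hasSum_of_eq h (fun n => ?_) rfl)
  have h1 := pow_ne_neg_one hq n
  have h2 : q ^ (n ^ 2) * q ^ n =
      q ^ (j * j + j) * q ^ (((n : ℤ) - j) * (n + j + 1)) := by
    rw [← zpow_add₀ hq0, ← zpow_natCast, ← zpow_natCast, ← zpow_add₀ hq0]
    congr 1
    push_cast
    ring
  have e1 : qPochRecip q ((n : ℤ) - (j + 1)) = (1 - q ^ n * (q ^ j)⁻¹) * qPochRecip q (n - j) := by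
    rw [show (n : ℤ) - (j + 1) = n - j - 1 by ring, qPochRecip_sub_one hq, zpow_sub₀ hq0,
      zpow_natCast, div_eq_mul_inv]
  have e2 : qPochRecip q ((n : ℤ) + j) =
      (1 - q ^ n * q ^ j * q) * qPochRecip q (n + j + 1) := by
    rw [qPochRecip_eq hq (n + j), zpow_add_one₀ hq0, zpow_add₀ hq0, zpow_natCast]
  have e3 : q ^ (2 * j + 1) = (q ^ j) ^ 2 * q := by
    rw [zpow_add_one₀ hq0, two_mul, zpow_add₀ hq0, sq]
  have hj := zpow_ne_zero j hq0
  refine Eq.symm ?_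
  calc -(1 - q ^ (2 * j + 1)) * q ^ (j * j + j) * durfeeTerm q (2 * j + 1) (n - j)
      = -(1 - (q ^ j) ^ 2 * q) * (q ^ (n ^ 2) * q ^ n) *
        (qPochRecip q (n - j) * qPochRecip q (n + j + 1)) := by
        rw [durfeeTerm, show (n : ℤ) - j + (2 * j + 1) = n + j + 1 by ring, h2, e3]
        ring
    _ = _ := by
        rw [rowTerm, rowTerm, e1, e2, show (n : ℤ) + (j + 1) = n + j + 1 by ring,
          zpow_add_one₀ hq0]
        field_simp
        ring

theorem rowSum_rec {q : ℂ} (hq0 : q ≠ 0) (hq : ‖q‖ < 1) (j : ℤ) :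
    rowSum q (j + 1) - rowSum q j =
      (qPent q (j + 1) - qPent q j * q ^ j) * (qPochInf q q)⁻¹ := by
  have h := tsum_rowTerm_mul_pow_rec hq0 hq j
  have e3 : q ^ (2 * j + 1) = (q ^ j) ^ 2 * q := by
    rw [zpow_add_one₀ hq0, two_mul, zpow_add₀ hq0, sq]
  rw [e3, zpow_add₀ hq0 (j * j)] at h
  rw [rowSum, rowSum, qTri_add_one hq0, qPent_add_one hq0, qPent_eq hq0]
  linear_combination qTri q j * h

theorem tsum_rowTerm_eq {q : ℂ} (hq0 : q ≠ 0) (hq : ‖q‖ < 1) (j : ℤ) :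
    qTri q j * (1 + q ^ j) * ∑' n, rowTerm q j n =
      (qPent q j + qPent q j * q ^ j) * (qPochInf q q)⁻¹ - rowSum q j := by
  rw [rowSum, qPent_eq hq0]
  linear_combination qTri q j * (1 + q ^ j) * tsum_rowTerm_add hq0 hq j

theorem summable_norm_qTri_one_add {q : ℂ} (hq0 : q ≠ 0) (hq : ‖q‖ < 1) {w : ℂ} (hw : w ≠ 0) :
    Summable fun j : ℤ => ‖qTri q j * (1 + q ^ j) * w ^ j‖ := by
  refine Summable.of_nonneg_of_le (fun _ => norm_nonneg _) (fun j => ?_)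
    ((summable_norm_qTri hq0 hq hw).add (summable_norm_qTri hq0 hq (mul_ne_zero hq0 hw)))
  rw [← qTri_mul_zpow, show qTri q j * (1 + q ^ j) * w ^ j =
    qTri q j * w ^ j + qTri q j * q ^ j * w ^ j by ring]
  exact norm_add_le _ _

theorem summable_norm_rowSum {q : ℂ} (hq0 : q ≠ 0) (hq : ‖q‖ < 1) {w : ℂ} (hw : w ≠ 0) :
    Summable fun j : ℤ => ‖rowSum q j * w ^ j‖ := by
  obtain ⟨M, hM0, hM⟩ := exists_norm_rowTerm_le hq
  have hg := (summable_geometric_of_lt_one (norm_nonneg q) hq).mul_left M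
  refine Summable.of_nonneg_of_le (fun _ => norm_nonneg _) (fun j => ?_)
    ((summable_norm_qTri_one_add hq0 hq hw).mul_right (∑' n, M * ‖q‖ ^ n))
  rw [rowSum, mul_right_comm, norm_mul]
  gcongr
  exact tsum_of_norm_bounded hg.hasSum fun n => (norm_rowTerm_mul_pow_le hq j n).trans (hM j n)

theorem summable_norm_qPent {q : ℂ} (hq0 : q ≠ 0) (hq : ‖q‖ < 1) {w : ℂ} (hw : w ≠ 0) :
    Summable fun j : ℤ => ‖qPent q j * w ^ j‖ := by
  simp only [qPent, mul_assoc, ← mul_zpow]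
  exact summable_norm_qTri (pow_ne_zero 3 hq0) (norm_pow_lt_one hq three_ne_zero)
    (mul_ne_zero hq0 hw)

theorem summable_norm_qPent_mul {q : ℂ} (hq0 : q ≠ 0) (hq : ‖q‖ < 1) {w : ℂ} (hw : w ≠ 0) :
    Summable fun j : ℤ => ‖qPent q j * q ^ j * w ^ j‖ := by
  simp only [mul_assoc, ← mul_zpow]
  exact summable_norm_qPent hq0 hq (mul_ne_zero hq0 hw)

/-- The left-hand side times `1 - s`, as a Laurent series in `w`. -/
theorem hasSum_lhs {q : ℂ} (hq0 : q ≠ 0) (hq : ‖q‖ < 1) {w : ℂ} (hw : w ≠ 0) (s : ℂ) :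
    HasSum (fun n : ℕ => (1 - s * q ^ n) *
        (qPoch (-w) q n * qPoch (-w⁻¹) q n * q ^ (n ^ 2) / qPoch q q (2 * n)))
      ((∑' j, qPent q j * w ^ j + ∑' j, qPent q j * q ^ j * w ^ j) * (qPochInf q q)⁻¹ -
        (1 + s) * ∑' j, rowSum q j * w ^ j) := by
  obtain ⟨M, hM0, hM⟩ := exists_norm_rowTerm_le hq
  have hsum : Summable fun p : ℕ × ℤ =>
      (1 - s * q ^ p.1) * rowTerm q p.2 p.1 * (qTri q p.2 * (1 + q ^ p.2) * w ^ p.2) := by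
    have hg : Summable fun n : ℕ => (1 + ‖s‖) * (M * ‖q‖ ^ n) :=
      ((summable_geometric_of_lt_one (norm_nonneg q) hq).mul_left M).mul_left _
    refine Summable.of_norm_bounded (hg.mul_of_nonneg (summable_norm_qTri_one_add hq0 hq hw)
      (fun n => by positivity) (fun j => norm_nonneg _)) fun p => ?_
    rw [norm_mul, norm_mul]
    gcongr
    · refine (norm_sub_le _ _).trans ?_
      rw [norm_one, norm_mul, norm_pow]
      gcongr
      exact mul_le_of_le_one_right (norm_nonneg _) (pow_le_one₀ (norm_nonneg q) hq.le)
    · exact hM _ _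
  -- The same double series is summed over j first here, and over n first in `h2`.
  have h1 : HasSum (fun n : ℕ => (1 - s * q ^ n) *
      (qPoch (-w) q n * qPoch (-w⁻¹) q n * q ^ (n ^ 2) / qPoch q q (2 * n))) _ :=
    hsum.hasSum.prod_fiberwise fun n => by
      refine hasSum_of_eq ((hasSum_finite_triple_symm hq0 hq hw n).mul_left
        ((1 - s * q ^ n) * (q ^ (n ^ 2) * (1 + q ^ n)⁻¹))) (fun j => ?_) ?_
      · rw [rowTerm]
        ring
      · have := pow_ne_neg_one hq n
        field_simp
  have h2 : HasSum (fun j : ℤ =>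
      ((qPent q j + qPent q j * q ^ j) * (qPochInf q q)⁻¹ - (1 + s) * rowSum q j) * w ^ j) _ :=
    ((Equiv.prodComm ℤ ℕ).hasSum_iff.mpr hsum.hasSum).prod_fiberwise fun j => by
      refine hasSum_of_eq ((((summable_rowTerm hq j).hasSum).sub
        ((summable_rowTerm_mul_pow hq j).hasSum.mul_left s)).mul_right
        (qTri q j * (1 + q ^ j) * w ^ j)) (fun n => ?_) ?_
      · simp only [Function.comp, Equiv.prodComm_apply, Prod.swap]
        ring
      · have h := tsum_rowTerm_eq hq0 hq j
        rw [rowSum] at h ⊢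
        linear_combination (-w ^ j) * h
  have h3 := (((summable_norm_qPent hq0 hq hw).of_norm.hasSum.add
    (summable_norm_qPent_mul hq0 hq hw).of_norm.hasSum).mul_right (qPochInf q q)⁻¹).sub
    ((summable_norm_rowSum hq0 hq hw).of_norm.hasSum.mul_left (1 + s))
  rw [← h2.unique (hasSum_of_eq h3 (fun j => by ring) rfl)]
  exact h1

theorem tsum_rowSum_rec {q : ℂ} (hq0 : q ≠ 0) (hq : ‖q‖ < 1) {w : ℂ} (hw : w ≠ 0) :
    (1 - w) * ∑' j, rowSum q j * w ^ j =
      (∑' j, qPent q j * w ^ j - w * ∑' j, qPent q j * q ^ j * w ^ j) * (qPochInf q q)⁻¹ := by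
  have hr := (summable_norm_rowSum hq0 hq hw).of_norm.hasSum
  have hu := (summable_norm_qPent hq0 hq hw).of_norm.hasSum
  have hv := (summable_norm_qPent_mul hq0 hq hw).of_norm.hasSum
  have h1 := (hasSum_shift_add hr 1).sub (hr.mul_left w)
  have h2 := ((hasSum_shift_add hu 1).sub (hv.mul_left w)).mul_right (qPochInf q q)⁻¹
  have h3 := h1.unique (hasSum_of_eq h2 (fun j => ?_) rfl)
  · linear_combination h3
  · rw [zpow_add_one₀ hw]
    linear_combination (w ^ j * w) * rowSum_rec hq0 hq j

/-! ### Continuity in z and conclusion -/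

theorem continuousAt_tsum_zpow {c : ℤ → ℂ}
    (hc : ∀ w : ℂ, w ≠ 0 → Summable fun j : ℤ => ‖c j * w ^ j‖) {w : ℂ} (hw : w ≠ 0) :
    ContinuousAt (fun w : ℂ => ∑' j, c j * w ^ j) w := by
  have hw' : 0 < ‖w‖ := norm_pos_iff.mpr hw
  -- On the annulus |w|/2 < |x| < 2|w|, nonnegative powers are dominated at 2w and negative ones at
  -- w/2.
  refine tendsto_tsum_of_dominated_convergence
    (bound := fun j : ℤ => ‖c j * (2 * w) ^ j‖ + ‖c j * (w / 2) ^ j‖)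
    ((hc _ (mul_ne_zero two_ne_zero hw)).add (hc _ (div_ne_zero hw two_ne_zero)))
    (fun j => (continuousAt_zpow₀ w j (Or.inl hw)).const_mul (c j)) ?_
  have hlt : ∀ᶠ x : ℂ in 𝓝 w, ‖x‖ < 2 * ‖w‖ :=
    continuous_norm.continuousAt.eventually_lt continuousAt_const (by linarith)
  have hgt : ∀ᶠ x : ℂ in 𝓝 w, ‖w‖ / 2 < ‖x‖ :=
    continuousAt_const.eventually_lt continuous_norm.continuousAt (by linarith)
  filter_upwards [hlt, hgt] with x hx1 hx2 j
  have hx : 0 < ‖x‖ := by linarith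
  simp only [norm_mul, norm_zpow, norm_div, RCLike.norm_ofNat]
  rw [← mul_add]
  gcongr
  rcases le_or_gt 0 j with h | h
  · have := zpow_le_zpow_left₀ h hx.le hx1.le
    have : 0 ≤ (‖w‖ / 2) ^ j := by positivity
    linarith
  · have := zpow_le_zpow_left₀ (a := ‖x‖⁻¹) (b := (‖w‖ / 2)⁻¹) (n := -j) (by omega)
      (by positivity) (by gcongr)
    rw [inv_zpow', inv_zpow', neg_neg] at this
    have : 0 ≤ (2 * ‖w‖) ^ j := by positivity
    linarith

theorem continuous_qPochInf {q : ℂ} (hq : ‖q‖ < 1) : Continuous fun a => qPochInf a q := by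
  refine continuous_iff_continuousAt.mpr fun a => ?_
  have h := tendsto_tprod_one_add_of_dominated_convergence (𝓕 := 𝓝 a)
    (f := fun a k => -(a * q ^ k)) (g := fun k => -(a * q ^ k))
    (bound := fun k : ℕ => (‖a‖ + 1) * ‖q‖ ^ k)
    ((summable_geometric_of_lt_one (norm_nonneg q) hq).mul_left _)
    (fun k => ((continuous_id.mul continuous_const).neg.tendsto a)) ?_
  · simpa only [ContinuousAt, qPochInf, sub_eq_add_neg] using h
  · have hlt : ∀ᶠ x : ℂ in 𝓝 a, ‖x‖ < ‖a‖ + 1 :=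
      continuous_norm.continuousAt.eventually_lt continuousAt_const (by linarith)
    filter_upwards [hlt] with x hx k
    rw [norm_neg, norm_mul, norm_pow]
    gcongr

/-- The product side of the main identity. -/
noncomputable def quintProd (q z : ℂ) : ℂ :=
  qPochInf (z * q) q * qPochInf (q / z) q *
    (qPochInf (q * z ^ 2) (q ^ 2) * qPochInf (q / z ^ 2) (q ^ 2))

theorem quintProd_identity_of_ne_one {q : ℂ} (hq0 : q ≠ 0) (hq : ‖q‖ < 1) {z : ℂ} (hz : z ≠ 0)
    (hz1 : z ≠ 1) :
    (∑' j, qPent q j * (z ^ 3) ^ j + ∑' j, qPent q j * q ^ j * (z ^ 3) ^ j) * (qPochInf q q)⁻¹ -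
        (1 + (z + 1 / z)) * ∑' j, rowSum q j * (z ^ 3) ^ j =
      (1 - (z + 1 / z)) * quintProd q z := by
  have hw := pow_ne_zero 3 hz
  have hP := qPochInf_self_ne_zero hq
  have h1 := tsum_rowSum_rec hq0 hq hw
  have hu := (summable_norm_qPent hq0 hq hw).of_norm.hasSum
  have hv := (summable_norm_qPent_mul hq0 hq hw).of_norm.hasSum
  have h2 := (hasSum_quintuple hq0 hq hz).unique (hu.sub (hv.mul_left z))
  rw [← quintProd] at h2
  generalize quintProd q z = R at *
  generalize ∑' j, rowSum q j * (z ^ 3) ^ j = r at *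
  generalize ∑' j, qPent q j * (z ^ 3) ^ j = u at *
  generalize ∑' j, qPent q j * q ^ j * (z ^ 3) ^ j = v at *
  generalize qPochInf q q = P at *
  field_simp at h1 ⊢
  -- Cancelling 1 - z rather than 1 - z³ keeps the primitive cube roots of unity: the factor 1 + z +
  -- z² is supplied by 1 + s.
  refine mul_left_cancel₀ (sub_ne_zero.mpr hz1.symm) ?_
  linear_combination (-1 : ℂ) * h1 - (z - z ^ 2 - 1) * h2

theorem quintProd_identity {q : ℂ} (hq0 : q ≠ 0) (hq : ‖q‖ < 1) {z : ℂ} (hz : z ≠ 0) :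
    (∑' j, qPent q j * (z ^ 3) ^ j + ∑' j, qPent q j * q ^ j * (z ^ 3) ^ j) * (qPochInf q q)⁻¹ -
        (1 + (z + 1 / z)) * ∑' j, rowSum q j * (z ^ 3) ^ j =
      (1 - (z + 1 / z)) * quintProd q z := by
  have hq2 := norm_sq_lt_one hq
  have hs : ContinuousAt (fun z : ℂ => z + 1 / z) z :=
    continuousAt_id.add (continuousAt_const.div continuousAt_id hz)
  have hcube {c : ℤ → ℂ} (hc : ∀ w : ℂ, w ≠ 0 → Summable fun j : ℤ => ‖c j * w ^ j‖) :
      ContinuousAt (fun z : ℂ => ∑' j, c j * (z ^ 3) ^ j) z :=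
    (continuousAt_tsum_zpow hc (pow_ne_zero 3 hz)).comp (f := fun z : ℂ => z ^ 3)
      (continuous_pow 3).continuousAt
  have hp1 {p : ℂ} (hp : ‖p‖ < 1) {f : ℂ → ℂ} (hf : ContinuousAt f z) :
      ContinuousAt (fun z => qPochInf (f z) p) z :=
    (continuous_qPochInf hp).continuousAt.comp hf
  have hL := (((hcube fun w hw => summable_norm_qPent hq0 hq hw).add
    (hcube fun w hw => summable_norm_qPent_mul hq0 hq hw)).mul_const (qPochInf q q)⁻¹).sub
    ((hs.const_add 1).mul (hcube fun w hw => summable_norm_rowSum hq0 hq hw))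
  have hR : ContinuousAt (fun z => (1 - (z + 1 / z)) * quintProd q z) z :=
    (hs.const_sub 1).mul (((hp1 hq (continuousAt_id.mul continuousAt_const)).mul
      (hp1 hq (continuousAt_const.div continuousAt_id hz))).mul
      ((hp1 hq2 (continuousAt_const.mul (continuousAt_id.pow 2))).mul
      (hp1 hq2 (continuousAt_const.div (continuousAt_id.pow 2) (pow_ne_zero 2 hz)))))
  rcases ne_or_eq z 1 with h1 | rfl
  · exact quintProd_identity_of_ne_one hq0 hq hz h1
  · refine tendsto_nhds_unique (hL.tendsto.mono_left (nhdsWithin_le_nhds (s := {1}ᶜ)))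
      ((hR.tendsto.mono_left nhdsWithin_le_nhds).congr' ?_)
    have hz0 : ∀ᶠ x : ℂ in 𝓝[≠] 1, x ≠ 0 := nhdsWithin_le_nhds (eventually_ne_nhds hz)
    filter_upwards [hz0, self_mem_nhdsWithin] with x hx hx1
    exact (quintProd_identity_of_ne_one hq0 hq hx hx1).symm

theorem mainTheorem10 (z q : ℂ) (hz : z ≠ 0) (hz1 : z + 1 / z ≠ 1) (hq : ‖q‖ < 1) :
    HasSum
      (fun n : ℕ =>
        (1 - (z + 1 / z) * q ^ n) / (1 - (z + 1 / z)) *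
          (qPoch (-z ^ 3) q n * qPoch (-1 / z ^ 3) q n * q ^ (n ^ 2) / qPoch q q (2 * n)))
      (qPochInf (z * q) q * qPochInf (q / z) q *
        (qPochInf (q * z ^ 2) (q ^ 2) * qPochInf (q / z ^ 2) (q ^ 2))) := by
  have hs : 1 - (z + 1 / z) ≠ 0 := sub_ne_zero.mpr hz1.symm
  -- Integer powers of q require q ≠ 0. At q = 0 only the term n = 0 remains, and every infinite
  -- product is 1.
  rcases eq_or_ne q 0 with rfl | hq0
  · convert hasSum_single (0 : ℕ) fun n hn => ?_ using 1
    · rw [one_div] at hs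
      simp [qPoch_zero, qPochInf, div_self hs]
    · simp [hn]
  · have h := (hasSum_lhs hq0 hq (pow_ne_zero 3 hz) (z + 1 / z)).mul_left (1 - (z + 1 / z))⁻¹
    rw [quintProd_identity hq0 hq hz, inv_mul_cancel_left₀ hs] at h
    refine hasSum_of_eq h (fun n => ?_) rfl
    rw [neg_div, one_div (z ^ 3)]
    ring
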